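/- **Setting.** A quantum circuit is a finite sequence of gates, each of which is one of the following: a Hadamard gate; a phase-shift gate $|0\rangle\langle 0|+e^{i\theta}|1\rangle\langle 1|$ with $\theta=2\pi c/2^t$ for integers $t\ge 1$ and $c$; a CNOT gate; a fan-out gate on $k+1$ qubits ($k\ge1$), $|y\rangle\bigotimes_{j=1}^k|x_j\rangle\mapsto|y\rangle\bigotimes_{j=1}^k|x_j\oplus y\rangle$; or a Toffoli gate on $k+1$ qubits ($k\ge1$), $\bigl(\bigotimes_{j=1}^k|x_j\rangle\bigr)|y\rangle\mapsto\bigl(\bigotimes_{j=1}^k|x_j\rangle\bigr)|y\oplus\bigwedge_{j=1}^kx_j\rangle$. There are no intermediate measurements. The depth of a circuit is the smallest $d$ such that its gates can be arranged into $d$ successive layers, where gates in the same layer act on pairwise disjoint sets of qubits and gates sharing a qubit keep their order. A circuit $C$ with $n$ input qubits, one output qubit, $p$ initialized and $q$ uninitialized ancillary qubits *computes* $f:\{0,1\}^n\to\{0,1\}$ if for all $x\in\{0,1\}^n$, $y\in\{0,1\}$ and every state $|\varphi\rangle$ of the $q$ uninitialized qubits, measuring the output qubit of $C\,|x\rangle|y\rangle|0^p\rangle|\varphi\rangle$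 in the computational basis yields $y\oplus f(x)$ with probability $1$. The parity function on $n$ bits maps $x$ to $1$ if $\sum_j x_j$ is odd and to $0$ otherwise. **Theorem.** Let $0\le\delta<1$ be a constant, and let $d,p,q,w:\mathbb N\to\mathbb N$ satisfy $d(n)=O((\log n)^\delta)$, $p(n)=O(\log n)$, $q(n)=n^{O(1)}$ and $w(n)=(\log n)^{O(1)}$. Then, for all sufficiently large $n$, the parity function on $n$ bits is not computed by any quantum circuit of depth at most $d(n)$ with $n$ input qubits, one output qubit, $p(n)$ initialized and $q(n)$ uninitialized ancillary qubits that consists of Hadamard gates, phase-shift gates as above, CNOT gates, fan-out gates acting on at most $w(n)$ qubits each, and Toffoli gates on arbitrarily many qubits. -/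

import Mathlib

namespace QCircuit

/-- A computational basis state of the qubits in `Q`. -/
abbrev Bits (Q : Type) : Type := Q → Bool

/-- Elementary gates on a set `Q` of qubits: Hadamard gates, phase-shift gates with angle
`2πc/2^t` (`t ≥ 1`, `c` an integer), CNOT gates, fan-out gates with one control and at least one
target, and Toffoli gates with at least one control and one target. -/
inductive Gate (Q : Type) : Type
  | hadamard (a : Q) : Gate Q
  | phase (a : Q) (c : ℤ) (t : ℕ) (ht : 1 ≤ t) : Gate Q
  | cnot (control target : Q) (h : control ≠ target) : Gate Q
  | fanout (control : Q) (targets : Finset Q) (hne : targets.Nonempty) (h : control ∉ targets) :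
      Gate Q
  | toffoli (controls : Finset Q) (target : Q) (hne : controls.Nonempty) (h : target ∉ controls) :
      Gate Q

/-- The linear map `|z⟩ ↦ |f z⟩` as a matrix in the computational basis. -/
def basisMap {Q : Type} [DecidableEq Q] [Fintype Q] (f : Bits Q → Bits Q) :
    Matrix (Bits Q) (Bits Q) ℂ :=
  Matrix.of fun z' z => if z' = f z then 1 else 0

namespace Gate

variable {Q : Type}

/-- The set of qubits on which a gate acts. -/
def support [DecidableEq Q] : Gate Q → Finset Q
  | hadamard a => {a}
  | phase a _ _ _ => {a}
  | cnot c t _ => {c, t}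
  | fanout c T _ _ => insert c T
  | toffoli S t _ _ => insert t S

/-- The matrix of a gate in the computational basis (row index: output, column index: input). -/
noncomputable def matrix [DecidableEq Q] [Fintype Q] : Gate Q → Matrix (Bits Q) (Bits Q) ℂ
  | hadamard a => Matrix.of fun z' z =>
      if ∀ r, r ≠ a → z' r = z r then
        (if z a = true ∧ z' a = true then -1 else 1) / ((Real.sqrt 2 : ℝ) : ℂ)
      else 0
  | phase a c t _ => Matrix.diagonal fun z =>
      if z a = true then Complex.exp (Complex.I * (2 * Real.pi * c / 2 ^ t)) else 1
  | cnot c t _ => basisMap fun z => Function.update z t (xor (z t) (z c))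
  | fanout c T _ _ => basisMap fun z r => if r ∈ T then xor (z r) (z c) else z r
  | toffoli S t _ _ => basisMap fun z =>
      Function.update z t (xor (z t) (decide (∀ j ∈ S, z j = true)))

/-- If the gate is a fan-out gate, then it acts on at most `w` qubits. -/
def FanoutAtMost [DecidableEq Q] (w : ℕ) : Gate Q → Prop
  | fanout c T _ _ => (insert c T).card ≤ w
  | _ => True

end Gate

/-- The qubits of a circuit with `n` input qubits, one output qubit, `p` initialized and `q`
uninitialized ancillary qubits. -/
inductive Qubit (n p q : ℕ) : Type
  | input (i : Fin n) : Qubit n p q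
  | output : Qubit n p q
  | initialized (i : Fin p) : Qubit n p q
  | uninitialized (i : Fin q) : Qubit n p q
  deriving DecidableEq, Fintype

/-- A circuit on the qubits `Q`: its gates, listed in an order in which they can be applied. -/
abbrev Circuit (Q : Type) : Type := List (Gate Q)

namespace Circuit

/-- The matrix of a circuit; the head of the list is applied first. -/
noncomputable def matrix {Q : Type} [DecidableEq Q] [Fintype Q] (C : Circuit Q) :
    Matrix (Bits Q) (Bits Q) ℂ :=
  C.foldl (fun U g => g.matrix * U) 1

/-- An arrangement of the gates of `C` into layers `0, …, d - 1`: of two gates that share a qubit,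
the one that is applied first lies in a strictly earlier layer. Equivalently, gates in the same
layer act on pairwise disjoint sets of qubits, and applying the gates layer by layer
changes only the order of gates on disjoint sets of qubits. -/
def IsLayering {Q : Type} [DecidableEq Q] (C : Circuit Q) (d : ℕ)
    (layer : Fin C.length → Fin d) : Prop :=
  ∀ i j, i < j → ¬ Disjoint (C.get i).support (C.get j).support → layer i < layer j

/-- The depth: the smallest possible number of layers. -/
noncomputable def depth {Q : Type} [DecidableEq Q] (C : Circuit Q) : ℕ :=
  sInf {d | ∃ layer : Fin C.length → Fin d, IsLayering C d layer}

variable {n p q : ℕ}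

/-- The initial state `|x⟩|y⟩|0^p⟩|φ⟩`, where `φ` is the state of the uninitialized qubits. -/
def initialState (p : ℕ) (x : Fin n → Bool) (y : Bool) (φ : EuclideanSpace ℂ (Fin q → Bool)) :
    Bits (Qubit n p q) → ℂ := fun z =>
  if (∀ i, z (.input i) = x i) ∧ z .output = y ∧ (∀ i, z (.initialized i) = false) then
    φ (fun i => z (.uninitialized i))
  else 0

/-- The probability that measuring the output qubit in the computational basis at the end of the
computation yields `b`. -/
noncomputable def outputProb (C : Circuit (Qubit n p q)) (x : Fin n → Bool) (y : Bool)
    (φ : EuclideanSpace ℂ (Fin q → Bool)) (b : Bool) : ℝ :=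
  ∑ z : Bits (Qubit n p q),
    if z .output = b then ‖(C.matrix.mulVec (initialState p x y φ)) z‖ ^ 2 else 0

/-- `C` computes `f`: on input `x`, with the output qubit initialized to `y`, the output is
`y ⊕ f x` with probability 1, for every (unit vector) state `φ` of the uninitialized qubits. By
convexity it is the same to ask this for every mixed state. -/
def Computes (C : Circuit (Qubit n p q)) (f : (Fin n → Bool) → Bool) : Prop :=
  ∀ (x : Fin n → Bool) (y : Bool) (φ : EuclideanSpace ℂ (Fin q → Bool)), ‖φ‖ = 1 →
    outputProb C x y φ (xor y (f x)) = 1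

end Circuit

/-- The parity function on `n` bits. -/
def parity (n : ℕ) (x : Fin n → Bool) : Bool :=
  decide (Odd (Finset.univ.filter fun i => x i = true).card)

end QCircuit

namespace QCircuit

section Locality

variable {Q : Type}

/-- `A` acts as `M ⊗ 1` with `M` acting on the qubits in `S`. -/
def IsLocal (S : Finset Q) (A : Matrix (Bits Q) (Bits Q) ℂ) : Prop :=
  (∀ z' z, (∃ r, r ∉ S ∧ z' r ≠ z r) → A z' z = 0) ∧
  ∀ z' z u' u, (∀ r, r ∉ S → z' r = z r) → (∀ r, r ∉ S → u' r = u r) →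
    (∀ r ∈ S, z' r = u' r) → (∀ r ∈ S, z r = u r) → A z' z = A u' u

theorem IsLocal.conjTranspose {S : Finset Q} {A : Matrix (Bits Q) (Bits Q) ℂ}
    (hA : IsLocal S A) : IsLocal S A.conjTranspose := by
  refine ⟨fun z' z ⟨r, hr, h⟩ => ?_, fun z' z u' u h₁ h₂ h₃ h₄ => ?_⟩
  · rw [Matrix.conjTranspose_apply, hA.1 z z' ⟨r, hr, h.symm⟩, star_zero]
  · rw [Matrix.conjTranspose_apply, Matrix.conjTranspose_apply,
      hA.2 z z' u u' (fun r hr => (h₁ r hr).symm) (fun r hr => (h₂ r hr).symm) h₄ h₃]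

variable [DecidableEq Q] [Fintype Q]

theorem IsLocal.mul_apply {S T : Finset Q} {A B : Matrix (Bits Q) (Bits Q) ℂ}
    (hA : IsLocal S A) (hB : IsLocal T B) (h : Disjoint S T) (z' z : Bits Q) :
    (A * B) z' z = A z' (fun r => if r ∈ S then z r else z' r) *
      B (fun r => if r ∈ S then z r else z' r) z := by
  rw [Matrix.mul_apply]
  refine Finset.sum_eq_single (fun r => if r ∈ S then z r else z' r) (fun u _ hu => ?_)
    (fun h => absurd (Finset.mem_univ _) h)
  obtain ⟨r, hr⟩ := Function.ne_iff.1 hu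
  by_cases hrS : r ∈ S
  · have hrT : r ∉ T := Finset.disjoint_left.1 h hrS
    rw [if_pos hrS] at hr
    rw [hB.1 u z ⟨r, hrT, hr⟩, mul_zero]
  · rw [if_neg hrS] at hr
    rw [hA.1 z' u ⟨r, hrS, hr.symm⟩, zero_mul]

theorem IsLocal.commute {S T : Finset Q} {A B : Matrix (Bits Q) (Bits Q) ℂ}
    (hA : IsLocal S A) (hB : IsLocal T B) (h : Disjoint S T) : Commute A B := by
  have hd : ∀ r ∈ S, r ∉ T := fun _ hr => Finset.disjoint_left.1 h hr
  ext z' z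
  rw [hA.mul_apply hB h, hB.mul_apply hA h.symm, mul_comm]
  by_cases hz : ∃ r, r ∉ S ∧ r ∉ T ∧ z' r ≠ z r
  · obtain ⟨r, hS, hT, hr⟩ := hz
    rw [hB.1 _ z ⟨r, hT, by simpa [hS] using hr⟩, hA.1 _ z ⟨r, hS, by simpa [hT] using hr⟩]
    simp
  · push Not at hz
    congr 1
    · apply hB.2 <;> grind
    · apply hA.2 <;> grind

theorem isLocal_basisMap {S : Finset Q} {f : Bits Q → Bits Q}
    (h₁ : ∀ z r, r ∉ S → f z r = z r)
    (h₂ : ∀ z u, (∀ r ∈ S, z r = u r) → ∀ r ∈ S, f z r = f u r) : IsLocal S (basisMap f) := by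
  refine ⟨fun z' z ⟨r, hr, h⟩ => ?_, fun z' z u' u hz hu h' h => ?_⟩
  · rw [basisMap, Matrix.of_apply, if_neg]
    rintro rfl
    exact h (h₁ z r hr)
  · simp only [basisMap, Matrix.of_apply]
    congr 1
    rw [eq_iff_iff, funext_iff, funext_iff]
    refine forall_congr' fun r => ?_
    by_cases hr : r ∈ S
    · rw [h' r hr, h₂ z u h r hr]
    · simp [h₁ _ r hr, hz r hr, hu r hr]

theorem isLocal_diagonal {S : Finset Q} {f : Bits Q → ℂ}
    (h : ∀ z u, (∀ r ∈ S, z r = u r) → f z = f u) : IsLocal S (Matrix.diagonal f) := by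
  refine ⟨fun z' z ⟨r, hr, hne⟩ => ?_, fun z' z u' u hz hu h₁ h₂ => ?_⟩
  · rw [Matrix.diagonal_apply_ne]
    rintro rfl
    exact hne rfl
  · have : z' = z ↔ u' = u := by
      rw [funext_iff, funext_iff]
      refine forall_congr' fun r => ?_
      by_cases hr : r ∈ S
      · rw [h₁ r hr, h₂ r hr]
      · simp [hz r hr, hu r hr]
    simp only [Matrix.diagonal_apply, this, h z' u' h₁]

theorem Gate.isLocal_matrix (g : Gate Q) : IsLocal g.support g.matrix := by
  cases g with
  | hadamard a =>
    refine ⟨fun z' z ⟨r, hr, hne⟩ => ?_, fun z' z u' u hz hu h₁ h₂ => ?_⟩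
    · simp only [Gate.support, Finset.mem_singleton] at hr
      rw [Gate.matrix, Matrix.of_apply, if_neg]
      exact fun h => hne (h r hr)
    · simp only [Gate.support, Finset.mem_singleton, forall_eq] at hz hu h₁ h₂
      simp only [Gate.matrix, Matrix.of_apply]
      rw [if_pos hz, if_pos hu, h₁, h₂]
  | phase a c t ht =>
    refine isLocal_diagonal fun z u h => ?_
    rw [h a (by simp [Gate.support])]
  | cnot c t h =>
    refine isLocal_basisMap (fun z r hr => ?_) (fun z u hzu r hr => ?_)
    · simp only [Gate.support, Finset.mem_insert, Finset.mem_singleton, not_or] at hr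
      simp [hr.2]
    · rw [Function.update_apply, Function.update_apply, hzu t (by simp [Gate.support]),
        hzu c (by simp [Gate.support]), hzu r hr]
  | fanout c T hne h =>
    refine isLocal_basisMap (fun z r hr => ?_) (fun z u hzu r hr => ?_)
    · simp only [Gate.support, Finset.mem_insert, not_or] at hr
      simp [hr.2]
    · rw [hzu c (by simp [Gate.support]), hzu r hr]
  | toffoli S t hne h =>
    refine isLocal_basisMap (fun z r hr => ?_) (fun z u hzu r hr => ?_)
    · simp only [Gate.support, Finset.mem_insert, not_or] at hr
      simp [hr.1]
    · have : (∀ j ∈ S, z j = true) ↔ ∀ j ∈ S, u j = true :=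
        forall₂_congr fun j hj => by rw [hzu j (by simp [Gate.support, hj])]
      rw [Function.update_apply, Function.update_apply, hzu t (by simp [Gate.support]),
        hzu r hr]
      simp only [this]

/-- `A` commutes with every operator that acts on qubits outside `S`. -/
def CommutesOutside (S : Finset Q) (A : Matrix (Bits Q) (Bits Q) ℂ) : Prop :=
  ∀ T B, Disjoint S T → IsLocal T B → Commute A B

theorem IsLocal.commutesOutside {S : Finset Q} {A : Matrix (Bits Q) (Bits Q) ℂ}
    (hA : IsLocal S A) : CommutesOutside S A :=
  fun _ _ h hB => hA.commute hB h

theorem CommutesOutside.mono {S T : Finset Q} {A : Matrix (Bits Q) (Bits Q) ℂ}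
    (hA : CommutesOutside S A) (h : S ⊆ T) : CommutesOutside T A :=
  fun U B hU hB => hA U B (hU.mono_left h) hB

theorem CommutesOutside.mul {S : Finset Q} {A B : Matrix (Bits Q) (Bits Q) ℂ}
    (hA : CommutesOutside S A) (hB : CommutesOutside S B) : CommutesOutside S (A * B) :=
  fun T D h hD => (hA T D h hD).mul_left (hB T D h hD)

end Locality

section Unitarity

variable {Q : Type} [DecidableEq Q] [Fintype Q]

theorem basisMap_mul_apply_of_involutive {f : Bits Q → Bits Q} (hf : Function.Involutive f)
    (A : Matrix (Bits Q) (Bits Q) ℂ) (z' z : Bits Q) : (basisMap f * A) z' z = A (f z') z := by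
  simp only [Matrix.mul_apply, basisMap, Matrix.of_apply, ite_mul, one_mul, zero_mul]
  simp [← hf.eq_iff]

theorem mul_basisMap_apply (f : Bits Q → Bits Q)
    (A : Matrix (Bits Q) (Bits Q) ℂ) (z' z : Bits Q) : (A * basisMap f) z' z = A z' (f z) := by
  simp [Matrix.mul_apply, basisMap]

theorem conjTranspose_basisMap_mul_self {f : Bits Q → Bits Q} (hf : Function.Injective f) :
    (basisMap f).conjTranspose * basisMap f = 1 := by
  ext z' z
  rw [mul_basisMap_apply, Matrix.conjTranspose_apply, basisMap, Matrix.of_apply,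
    Matrix.one_apply]
  simp only [hf.eq_iff, eq_comm (a := z)]
  split_ifs <;> simp

theorem hadamard_mul_hadamard_apply (a : Q) (z' z : Bits Q) :
    ((Gate.hadamard a).matrix * (Gate.hadamard a).matrix) z' z =
      (1 : Matrix (Bits Q) (Bits Q) ℂ) z' z := by
  have key : ∀ u : Bits Q, (∀ r, r ≠ a → u r = z r) ↔
      u ∈ ({Function.update z a true, Function.update z a false} : Finset (Bits Q)) := by
    intro u
    simp only [Finset.mem_insert, Finset.mem_singleton, Function.eq_update_iff]
    cases u a <;> simp
  have hne : Function.update z a true ≠ Function.update z a false := fun h => by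
    simpa using congrFun h a
  have h2 : ((Real.sqrt 2 : ℝ) : ℂ) * ((Real.sqrt 2 : ℝ) : ℂ) = 2 := by
    rw [← Complex.ofReal_mul, Real.mul_self_sqrt (by norm_num)]
    norm_num
  have h0 : ((Real.sqrt 2 : ℝ) : ℂ) ≠ 0 := by
    rw [Complex.ofReal_ne_zero]
    positivity
  rw [Matrix.mul_apply, ← Finset.sum_subset (Finset.subset_univ
    ({Function.update z a true, Function.update z a false} : Finset (Bits Q))),
    Finset.sum_pair hne]
  · have hz : ∀ b, (∀ r, r ≠ a → z' r = Function.update z a b r) ↔ ∀ r, r ≠ a → z' r = z r :=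
      fun b => forall₂_congr fun r hr => by rw [Function.update_of_ne hr]
    have hz₂ : ∀ b, (∀ r, r ≠ a → Function.update z a b r = z r) :=
      fun b r hr => by rw [Function.update_of_ne hr]
    simp only [Gate.matrix, Matrix.of_apply, hz, if_pos (hz₂ _), Function.update_self]
    by_cases h : ∀ r, r ≠ a → z' r = z r
    · simp only [if_pos h, Matrix.one_apply]
      have : z' = z ↔ z' a = z a :=
        ⟨fun h => by rw [h], fun h' => funext fun r => by
          by_cases hr : r = a
          · rw [hr, h']
          · exact h r hr⟩
      simp only [this]
      cases z' a <;> cases z a <;> simp <;> field_simp <;> simp [pow_two, h2] <;> norm_num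
    · rw [if_neg h, if_neg h, Matrix.one_apply_ne]
      · simp
      · rintro rfl
        exact h fun _ _ => rfl
  · intro u _ hu
    rw [← key] at hu
    simp only [Gate.matrix, Matrix.of_apply]
    rw [if_neg hu, mul_zero]

theorem isHermitian_hadamard (a : Q) :
    (Gate.hadamard a).matrix.conjTranspose = (Gate.hadamard a).matrix := by
  ext z' z
  simp only [Matrix.conjTranspose_apply, Gate.matrix, Matrix.of_apply, and_comm (a := z' a = true),
    eq_comm (a := z _)]
  split_ifs <;> simp

theorem toffoli_involutive {S : Finset Q} {t : Q} (h : t ∉ S) : Function.Involutive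
    fun z : Bits Q => Function.update z t (xor (z t) (decide (∀ j ∈ S, z j = true))) := by
  intro z
  have : ∀ b, (∀ j ∈ S, Function.update z t b j = true) ↔ ∀ j ∈ S, z j = true :=
    fun b => forall₂_congr fun j hj => by
      rw [Function.update_of_ne (ne_of_mem_of_not_mem hj h)]
  simp only [this, Function.update_self, Function.update_idem, Bool.xor_assoc, Bool.xor_self,
    Bool.xor_false, Function.update_eq_self]

theorem Gate.conjTranspose_matrix_mul_self (g : Gate Q) :
    g.matrix.conjTranspose * g.matrix = 1 := by
  cases g with
  | hadamard a =>
    rw [isHermitian_hadamard]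
    ext z' z
    exact hadamard_mul_hadamard_apply a z' z
  | phase a c t ht =>
    rw [Gate.matrix, Matrix.diagonal_conjTranspose, Matrix.diagonal_mul_diagonal,
      ← Matrix.diagonal_one]
    congr 1
    ext z
    simp only [Pi.star_apply]
    split_ifs with h
    · have : Complex.I * (2 * Real.pi * c / 2 ^ t) =
          ((2 * Real.pi * c / 2 ^ t : ℝ) : ℂ) * Complex.I := by
        push_cast
        ring
      rw [this, RCLike.star_def, ← Complex.normSq_eq_conj_mul_self, Complex.normSq_eq_norm_sq,
        Complex.norm_exp_ofReal_mul_I]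
      simp
    · simp
  | cnot c t h =>
    refine conjTranspose_basisMap_mul_self (Function.Involutive.injective fun z => ?_)
    ext r
    by_cases hr : r = t
    · subst hr
      simp [h]
    · simp [hr]
  | fanout c T hne h =>
    refine conjTranspose_basisMap_mul_self (Function.Involutive.injective fun z => ?_)
    ext r
    by_cases hr : r ∈ T <;> simp [hr, h]
  | toffoli S t hne h =>
    exact conjTranspose_basisMap_mul_self (toffoli_involutive h).injective

theorem Circuit.matrix_append_singleton (C : Circuit Q) (g : Gate Q) :
    Circuit.matrix (C ++ [g]) = g.matrix * C.matrix := by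
  simp [Circuit.matrix]

theorem Circuit.conjTranspose_matrix_mul_self (C : Circuit Q) :
    C.matrix.conjTranspose * C.matrix = 1 := by
  induction C using List.reverseRecOn with
  | nil => simp [Circuit.matrix]
  | append_singleton C g ih =>
    rw [matrix_append_singleton, Matrix.conjTranspose_mul, Matrix.mul_assoc,
      ← Matrix.mul_assoc _ g.matrix, g.conjTranspose_matrix_mul_self, Matrix.one_mul, ih]

end Unitarity

section Frobenius

open scoped Matrix.Norms.Frobenius

variable {Q : Type} [DecidableEq Q] [Fintype Q]

theorem frobenius_norm_sq {ι : Type*} [Fintype ι] (A : Matrix ι ι ℂ) :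
    ‖A‖ ^ 2 = ∑ i, ∑ j, ‖A i j‖ ^ 2 := by
  have h : 0 ≤ ∑ i, ∑ j, ‖A i j‖ ^ 2 := by positivity
  rw [Matrix.frobenius_norm_def, ← Real.sqrt_eq_rpow]
  simp only [Real.rpow_two]
  exact Real.sq_sqrt h

theorem ofReal_frobenius_norm_sq {ι : Type*} [Fintype ι] (A : Matrix ι ι ℂ) :
    ((‖A‖ ^ 2 : ℝ) : ℂ) = (A.conjTranspose * A).trace := by
  rw [frobenius_norm_sq, Finset.sum_comm]
  simp only [Matrix.trace, Matrix.diag_apply, Matrix.mul_apply, Matrix.conjTranspose_apply,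
    Complex.ofReal_sum, RCLike.star_def, ← Complex.normSq_eq_conj_mul_self,
    Complex.normSq_eq_norm_sq]

theorem frobenius_norm_mul_of_unitary {ι : Type*} [Fintype ι] [DecidableEq ι] {U : Matrix ι ι ℂ}
    (hU : U.conjTranspose * U = 1) (A : Matrix ι ι ℂ) : ‖U * A‖ = ‖A‖ := by
  have : ((‖U * A‖ ^ 2 : ℝ) : ℂ) = ((‖A‖ ^ 2 : ℝ) : ℂ) := by
    rw [ofReal_frobenius_norm_sq, ofReal_frobenius_norm_sq, Matrix.conjTranspose_mul,
      Matrix.mul_assoc, ← Matrix.mul_assoc _ U, hU, Matrix.one_mul]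
  exact (sq_eq_sq₀ (norm_nonneg _) (norm_nonneg _)).1 (Complex.ofReal_injective this)

theorem frobenius_norm_mul_unitary {ι : Type*} [Fintype ι] [DecidableEq ι] {U : Matrix ι ι ℂ}
    (hU : U.conjTranspose * U = 1) (A : Matrix ι ι ℂ) : ‖A * U‖ = ‖A‖ := by
  rw [← Matrix.frobenius_norm_conjTranspose, Matrix.conjTranspose_mul,
    frobenius_norm_mul_of_unitary, Matrix.frobenius_norm_conjTranspose]
  rw [Matrix.conjTranspose_conjTranspose]
  exact mul_eq_one_comm.1 hU

theorem card_filter_forall_eq_mul (S : Finset Q) (b : Bool) :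
    (Finset.univ.filter fun z : Bits Q => ∀ j ∈ S, z j = b).card * 2 ^ S.card =
      2 ^ Fintype.card Q := by
  have : (Finset.univ.filter fun z : Bits Q => ∀ j ∈ S, z j = b) =
      Fintype.piFinset fun j => if j ∈ S then {b} else Finset.univ := by
    ext z
    simp only [Finset.mem_filter, Finset.mem_univ, true_and, Fintype.mem_piFinset]
    refine forall_congr' fun j => ?_
    by_cases hj : j ∈ S <;> simp [hj]
  have h₂ : (2 : ℕ) ^ S.card = ∏ j : Q, if j ∈ S then 2 else 1 := by
    simp [Finset.prod_ite_mem]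
  rw [this, Fintype.card_piFinset, h₂, ← Finset.prod_mul_distrib, ← Finset.card_univ,
    ← Finset.prod_const]
  refine Finset.prod_congr rfl fun j _ => ?_
  by_cases hj : j ∈ S <;> simp [hj]

theorem norm_toffoli_sub_one_sq_le (S : Finset Q) (t : Q) (hne : S.Nonempty) (h : t ∉ S) :
    ‖(Gate.toffoli S t hne h).matrix - 1‖ ^ 2 ≤ 2 * (2 ^ Fintype.card Q / 2 ^ S.card) := by
  rw [frobenius_norm_sq, Finset.sum_comm]
  have hcol : ∀ z : Bits Q, ∑ z', ‖((Gate.toffoli S t hne h).matrix - 1) z' z‖ ^ 2 ≤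
      if ∀ j ∈ S, z j = true then (2 : ℝ) else 0 := by
    intro z
    simp only [Gate.matrix, Matrix.sub_apply, basisMap, Matrix.of_apply, Matrix.one_apply]
    split_ifs with hz
    · have hsum : ∀ u : Bits Q,
          ∑ z', ‖(if z' = u then (1 : ℂ) else 0) - (if z' = z then 1 else 0)‖ ^ 2 ≤ 2 := by
        intro u
        calc ∑ z', ‖(if z' = u then (1 : ℂ) else 0) - (if z' = z then 1 else 0)‖ ^ 2
            ≤ ∑ z', ((if z' = u then (1 : ℝ) else 0) + (if z' = z then 1 else 0)) := by
              refine Finset.sum_le_sum fun z' _ => ?_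
              split_ifs <;> simp
          _ = 2 := by
              rw [Finset.sum_add_distrib, Finset.sum_ite_eq', Finset.sum_ite_eq',
                if_pos (Finset.mem_univ _), if_pos (Finset.mem_univ _)]
              norm_num
      exact hsum _
    · simp [hz]
  refine (Finset.sum_le_sum fun z _ => hcol z).trans (le_of_eq ?_)
  have hc : ((Finset.univ.filter fun z : Bits Q => ∀ j ∈ S, z j = true).card : ℝ) * 2 ^ S.card =
      2 ^ Fintype.card Q := by exact_mod_cast card_filter_forall_eq_mul S true
  rw [← Finset.sum_filter, Finset.sum_const, nsmul_eq_mul, ← hc]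
  field_simp

theorem Circuit.norm_matrix_sub_matrix_filter_le (C : Circuit Q) (keep : Gate Q → Bool) {ε : ℝ}
    (hε : 0 ≤ ε) (h : ∀ g ∈ C, keep g = false → ‖g.matrix - 1‖ ≤ ε) :
    ‖C.matrix - Circuit.matrix (C.filter keep)‖ ≤ C.length * ε := by
  induction C using List.reverseRecOn with
  | nil => simp [Circuit.matrix]
  | append_singleton C g ih =>
    have ih := ih fun g hg => h g (by simp [hg])
    rw [List.filter_append, List.length_append, matrix_append_singleton]
    push_cast
    simp only [List.length_singleton, Nat.cast_one, add_mul, one_mul]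
    cases hg : keep g with
    | true =>
      rw [List.filter_singleton, hg, cond_true, matrix_append_singleton, ← Matrix.mul_sub,
        frobenius_norm_mul_of_unitary g.conjTranspose_matrix_mul_self]
      linarith
    | false =>
      rw [List.filter_singleton, hg, cond_false, List.append_nil]
      set C' : Circuit Q := C.filter keep
      have : g.matrix * Circuit.matrix C - C'.matrix =
          g.matrix * (Circuit.matrix C - C'.matrix) + (g.matrix - 1) * C'.matrix := by
        noncomm_ring
      rw [this]
      refine (norm_add_le _ _).trans ?_
      rw [frobenius_norm_mul_of_unitary g.conjTranspose_matrix_mul_self,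
        frobenius_norm_mul_unitary C'.conjTranspose_matrix_mul_self]
      exact add_le_add ih (h g (by simp) hg)

end Frobenius

section LightCone

variable {Q : Type} [DecidableEq Q]

theorem Gate.support_nonempty (g : Gate Q) : g.support.Nonempty := by
  cases g <;> simp [Gate.support]

theorem Circuit.exists_isLayering {C : Circuit Q} {d : ℕ} (h : C.depth ≤ d) :
    ∃ layer : Fin C.length → Fin d, IsLayering C d layer := by
  have hne : {d | ∃ layer : Fin C.length → Fin d, IsLayering C d layer}.Nonempty :=
    ⟨C.length, id, fun _ _ hij _ => hij⟩
  obtain ⟨layer, hl⟩ := Nat.sInf_mem hne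
  exact ⟨fun i => Fin.castLE h (layer i), fun i j hij hd => hl i j hij hd⟩

variable [Fintype Q]

/-- Heisenberg evolution of an observable through a layered circuit enlarges its support at most
by a factor `W` per layer. The second component of an entry of `L` is its layer, and `h r`
exceeds the layers of all gates in `L` that act on `r`. -/
theorem exists_commutesOutside_conj (W : ℕ) (hW : 1 ≤ W) (L : List (Gate Q × ℕ))
    (hL : L.Pairwise fun a b => ¬ Disjoint a.1.support b.1.support → a.2 < b.2)
    (hs : ∀ a ∈ L, a.1.support.card ≤ W) (S : Finset Q) (h : Q → ℕ)
    (hh : ∀ a ∈ L, ∀ r ∈ S, r ∈ a.1.support → a.2 < h r)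
    (A : Matrix (Bits Q) (Bits Q) ℂ) (hA : CommutesOutside S A) :
    ∃ S' : Finset Q, S'.card ≤ ∑ r ∈ S, W ^ h r ∧
      CommutesOutside S' ((Circuit.matrix (L.map Prod.fst)).conjTranspose * A *
        Circuit.matrix (L.map Prod.fst)) := by
  induction L using List.reverseRecOn generalizing S h A with
  | nil =>
    refine ⟨S, ?_, by simpa [Circuit.matrix] using hA⟩
    rw [Finset.card_eq_sum_ones]
    exact Finset.sum_le_sum fun r _ => Nat.one_le_pow _ _ hW
  | append_singleton L a ih =>
    obtain ⟨g, l⟩ := a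
    rw [List.pairwise_append] at hL
    have hg : ∀ a ∈ L, ¬ Disjoint a.1.support g.support → a.2 < l :=
      fun a ha => hL.2.2 a ha (g, l) (by simp)
    have ih := ih hL.1 fun a ha => hs a (by simp [ha])
    have hm : (Circuit.matrix ((L ++ [(g, l)]).map Prod.fst)).conjTranspose * A *
        Circuit.matrix ((L ++ [(g, l)]).map Prod.fst) =
        (Circuit.matrix (L.map Prod.fst)).conjTranspose * (g.matrix.conjTranspose * A * g.matrix) *
          Circuit.matrix (L.map Prod.fst) := by
      rw [List.map_append, List.map_singleton, Circuit.matrix_append_singleton,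
        Matrix.conjTranspose_mul]
      simp only [Matrix.mul_assoc]
    rw [hm]
    by_cases hd : Disjoint S g.support
    · have : g.matrix.conjTranspose * A * g.matrix = A := by
        rw [Matrix.mul_assoc, (hA _ _ hd g.isLocal_matrix).eq, ← Matrix.mul_assoc,
          g.conjTranspose_matrix_mul_self, Matrix.one_mul]
      rw [this]
      exact ih S h (fun a ha => hh a (by simp [ha])) A hA
    · have hgl := g.isLocal_matrix
      obtain ⟨S', hS', hS''⟩ := ih (S ∪ g.support) (fun r => if r ∈ g.support then l else h r)
        (fun a ha r hr hra => by
          by_cases hrg : r ∈ g.support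
          · simp only [hrg, if_true]
            exact hg a ha (Finset.not_disjoint_iff.2 ⟨r, hra, hrg⟩)
          · simp only [hrg, if_false]
            exact hh a (by simp [ha]) r (by simpa [hrg] using hr) hra)
        _ (((hgl.conjTranspose.commutesOutside.mono Finset.subset_union_right).mul
            (hA.mono Finset.subset_union_left)).mul
            (hgl.commutesOutside.mono Finset.subset_union_right))
      refine ⟨S', hS'.trans ?_, hS''⟩
      obtain ⟨r₀, hr₀, hr₀g⟩ := Finset.not_disjoint_iff.1 hd
      have hlt : l < h r₀ := hh (g, l) (by simp) r₀ hr₀ hr₀g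
      have hcard : g.support.card ≤ W := hs (g, l) (by simp)
      rw [← Finset.sdiff_union_self_eq_union, Finset.sum_union Finset.sdiff_disjoint,
        ← Finset.sum_sdiff (Finset.inter_subset_left (s₁ := S) (s₂ := g.support)),
        Finset.sdiff_inter_self_left]
      refine add_le_add (le_of_eq (Finset.sum_congr rfl fun r hr => ?_)) ?_
      · rw [if_neg (Finset.mem_sdiff.1 hr).2]
      · calc ∑ r ∈ g.support, W ^ (if r ∈ g.support then l else h r)
            = g.support.card * W ^ l := by
              rw [Finset.sum_congr rfl fun r hr => by rw [if_pos hr], Finset.sum_const,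
                smul_eq_mul]
          _ ≤ W * W ^ l := Nat.mul_le_mul_right _ hcard
          _ = W ^ (l + 1) := (pow_succ' W l).symm
          _ ≤ W ^ h r₀ := Nat.pow_le_pow_right hW hlt
          _ ≤ ∑ r ∈ S ∩ g.support, W ^ h r :=
              Finset.single_le_sum (f := fun r => W ^ h r) (fun _ _ => Nat.zero_le _)
                (Finset.mem_inter.2 ⟨hr₀, hr₀g⟩)

theorem Circuit.length_le {C : Circuit Q} {d : ℕ} (h : C.depth ≤ d) :
    C.length ≤ d * Fintype.card Q := by
  obtain ⟨layer, hl⟩ := exists_isLayering h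
  choose r hr using fun i => (C.get i).support_nonempty
  have hne : ∀ i j, i < j → layer i = layer j → r i ≠ r j := fun i j hij hlay he =>
    (hl i j hij (Finset.not_disjoint_iff.2 ⟨r i, hr i, he ▸ hr j⟩)).ne hlay
  have hinj : Function.Injective fun i => (layer i, r i) := by
    intro i j hij
    obtain ⟨h₁, h₂⟩ := Prod.mk.inj hij
    rcases lt_trichotomy i j with hlt | heq | hlt
    · exact absurd h₂ (hne i j hlt h₁)
    · exact heq
    · exact absurd h₂.symm (hne j i hlt h₁.symm)
  simpa using Fintype.card_le_of_injective _ hinj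

/-- The light cone of an observable on the qubit `o` in a circuit of depth `d` that
consists of gates on at most `W` qubits has at most `W ^ d` elements. -/
theorem Circuit.exists_lightCone {C : Circuit Q} {d W : ℕ} (h : C.depth ≤ d)
    (keep : Gate Q → Bool) (hW : 1 ≤ W) (hs : ∀ g ∈ C, keep g = true → g.support.card ≤ W)
    (o : Q) (A : Matrix (Bits Q) (Bits Q) ℂ) (hA : CommutesOutside {o} A) :
    ∃ S : Finset Q, S.card ≤ W ^ d ∧
      CommutesOutside S ((Circuit.matrix (C.filter keep)).conjTranspose * A *
        Circuit.matrix (C.filter keep)) := by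
  obtain ⟨layer, hl⟩ := exists_isLayering h
  let L : List (Gate Q × ℕ) := List.ofFn fun i => (C.get i, (layer i : ℕ))
  have hLC : L.map Prod.fst = C := by
    simp [L, List.map_ofFn, Function.comp_def]
  have hL : L.Pairwise fun a b => ¬ Disjoint a.1.support b.1.support → a.2 < b.2 :=
    List.pairwise_ofFn.2 fun i j hij => hl i j hij
  have hmap : (L.filter fun a => keep a.1).map Prod.fst = C.filter keep := by
    conv_rhs => rw [← hLC, List.filter_map]
    rfl
  have hmem : ∀ a ∈ L, a.1 ∈ C ∧ a.2 < d := by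
    intro a ha
    obtain ⟨i, rfl⟩ := (List.mem_ofFn' _ _).1 ha
    exact ⟨List.get_mem _ _, (layer i).2⟩
  obtain ⟨S, hS, hS'⟩ := exists_commutesOutside_conj W hW (L.filter fun a => keep a.1)
    (hL.filter _) (fun a ha => hs a.1 (hmem a (List.mem_filter.1 ha).1).1 (List.mem_filter.1 ha).2)
    {o} (fun _ => d) (fun a ha _ _ _ => (hmem a (List.mem_filter.1 ha).1).2) A hA
  rw [hmap] at hS'
  exact ⟨S, by simpa using hS, hS'⟩

end LightCone

section OutputAmplitude

variable {Q : Type} [DecidableEq Q]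

/-- Negation of the bit `i`. -/
def flip (i : Q) (z : Bits Q) : Bits Q := Function.update z i (!z i)

theorem flip_involutive (i : Q) : Function.Involutive (flip i : Bits Q → Bits Q) := fun z => by
  simp [flip]

variable [Fintype Q]

/-- The projection onto the basis states in which the qubit `o` is `1`. -/
def proj (o : Q) : Matrix (Bits Q) (Bits Q) ℂ :=
  Matrix.diagonal fun z => if z o = true then 1 else 0

theorem commutesOutside_proj (o : Q) : CommutesOutside {o} (proj o) :=
  (isLocal_diagonal fun z u h => by rw [h o (by simp)]).commutesOutside

/-- The component of the state `U|z⟩` in which the qubit `o` is `1`. -/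
def outVec (o : Q) (U : Matrix (Bits Q) (Bits Q) ℂ) (z : Bits Q) : EuclideanSpace ℂ (Bits Q) :=
  WithLp.toLp 2 fun z' => if z' o = true then U z' z else 0

theorem norm_outVec_sq (o : Q) (U : Matrix (Bits Q) (Bits Q) ℂ) (z : Bits Q) :
    ‖outVec o U z‖ ^ 2 = ∑ z', if z' o = true then ‖U z' z‖ ^ 2 else 0 := by
  rw [EuclideanSpace.norm_sq_eq]
  refine Finset.sum_congr rfl fun z' _ => ?_
  simp only [outVec]
  split_ifs <;> simp

theorem ofReal_norm_outVec_sq (o : Q) (U : Matrix (Bits Q) (Bits Q) ℂ) (z : Bits Q) :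
    ((‖outVec o U z‖ ^ 2 : ℝ) : ℂ) = (U.conjTranspose * proj o * U) z z := by
  rw [norm_outVec_sq, Matrix.mul_assoc, Matrix.mul_apply, Complex.ofReal_sum]
  refine Finset.sum_congr rfl fun z' _ => ?_
  rw [proj, Matrix.diagonal_mul, Matrix.conjTranspose_apply]
  split_ifs
  · rw [one_mul, RCLike.star_def, ← Complex.normSq_eq_conj_mul_self, Complex.normSq_eq_norm_sq]
  · simp

theorem sq_norm_outVec_sub_le (o : Q) (U V : Matrix (Bits Q) (Bits Q) ℂ) (z : Bits Q) :
    (‖outVec o U z‖ - ‖outVec o V z‖) ^ 2 ≤ ∑ z', ‖(U - V) z' z‖ ^ 2 := by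
  have h₁ : |‖outVec o U z‖ - ‖outVec o V z‖| ≤ ‖outVec o U z - outVec o V z‖ :=
    abs_norm_sub_norm_le _ _
  rw [← sq_abs]
  refine (pow_le_pow_left₀ (abs_nonneg _) h₁ 2).trans ?_
  rw [EuclideanSpace.norm_sq_eq]
  refine Finset.sum_le_sum fun z' _ => ?_
  simp only [outVec, PiLp.sub_apply, Matrix.sub_apply]
  split_ifs
  · rfl
  · simp

theorem isLocal_basisMap_flip (i : Q) : IsLocal {i} (basisMap (flip i)) := by
  refine isLocal_basisMap (fun z r hr => ?_) (fun z u h r hr => ?_)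
  · simp only [Finset.mem_singleton] at hr
    simp [flip, hr]
  · obtain rfl := Finset.mem_singleton.1 hr
    simp [flip, h r hr]

theorem CommutesOutside.flip_apply {S : Finset Q} {A : Matrix (Bits Q) (Bits Q) ℂ}
    (hA : CommutesOutside S A) {i : Q} (hi : i ∉ S) (z : Bits Q) :
    A (flip i z) (flip i z) = A z z := by
  have h := congrFun (congrFun (hA {i} _ (by simpa using hi) (isLocal_basisMap_flip i)).eq
    (flip i z)) z
  rwa [mul_basisMap_apply, basisMap_mul_apply_of_involutive (flip_involutive i),
    flip_involutive i z] at h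

theorem norm_outVec_flip {S : Finset Q} {o : Q} {U : Matrix (Bits Q) (Bits Q) ℂ}
    (hU : CommutesOutside S (U.conjTranspose * proj o * U)) {i : Q} (hi : i ∉ S) (z : Bits Q) :
    ‖outVec o U (flip i z)‖ = ‖outVec o U z‖ := by
  refine (sq_eq_sq₀ (norm_nonneg _) (norm_nonneg _)).1 (Complex.ofReal_injective ?_)
  rw [ofReal_norm_outVec_sq, ofReal_norm_outVec_sq, hU.flip_apply hi]

end OutputAmplitude

section Parity

open scoped Matrix.Norms.Frobenius

variable {n p q : ℕ}

theorem initialState_single (z : Bits (Qubit n p q)) (hz : ∀ i, z (.initialized i) = false) :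
    Circuit.initialState p (fun i => z (.input i)) (z .output)
      (EuclideanSpace.single (fun i => z (.uninitialized i)) 1) = Pi.single z 1 := by
  ext u
  have : u = z ↔ ((∀ i, u (.input i) = z (.input i)) ∧ u .output = z .output ∧
      ∀ i, u (.initialized i) = false) ∧
      (fun i => u (.uninitialized i)) = fun i => z (.uninitialized i) := by
    refine ⟨by rintro rfl; simp [hz], fun ⟨⟨h₁, h₂, h₃⟩, h₄⟩ => funext fun r => ?_⟩
    cases r with
    | input i => exact h₁ i
    | output => exact h₂
    | initialized i => rw [h₃, hz]
    | uninitialized i => exact congrFun h₄ i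
  rw [Circuit.initialState, Pi.single_apply]
  simp only [this, PiLp.single_apply]
  split_ifs <;> simp_all

theorem Circuit.Computes.norm_outVec {C : Circuit (Qubit n p q)} {f : (Fin n → Bool) → Bool}
    (hC : C.Computes f) (z : Bits (Qubit n p q)) (hz : ∀ i, z (.initialized i) = false) :
    ‖outVec .output C.matrix z‖ =
      if xor (z .output) (f fun i => z (.input i)) = true then 1 else 0 := by
  have h := hC (fun i => z (.input i)) (z .output)
    (EuclideanSpace.single (fun i => z (.uninitialized i)) 1) (by simp)
  rw [Circuit.outputProb, initialState_single z hz] at h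
  simp only [Matrix.mulVec_single_one, Matrix.col_apply] at h
  have htot : ∑ z', ‖C.matrix z' z‖ ^ 2 = 1 := by
    have := congrFun (congrFun C.conjTranspose_matrix_mul_self z) z
    rw [Matrix.mul_apply, Matrix.one_apply_eq] at this
    simp only [Matrix.conjTranspose_apply, RCLike.star_def, ← Complex.normSq_eq_conj_mul_self,
      Complex.normSq_eq_norm_sq] at this
    exact_mod_cast this
  have hsq := norm_outVec_sq Qubit.output C.matrix z
  split_ifs with hb
  · rw [hb] at h
    rw [h] at hsq
    exact (pow_eq_one_iff_of_nonneg (norm_nonneg _) two_ne_zero).1 hsq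
  · rw [Bool.not_eq_true] at hb
    rw [hb] at h
    have hsplit : ∑ z', ‖C.matrix z' z‖ ^ 2 =
        (∑ z' : Bits (Qubit n p q), if z' .output = false then ‖C.matrix z' z‖ ^ 2 else 0) +
        ∑ z' : Bits (Qubit n p q), if z' .output = true then ‖C.matrix z' z‖ ^ 2 else 0 := by
      rw [← Finset.sum_add_distrib]
      refine Finset.sum_congr rfl fun z' _ => ?_
      cases z' .output <;> simp
    rw [htot, h, ← hsq] at hsplit
    exact pow_eq_zero_iff two_ne_zero |>.1 (by linarith)

theorem parity_update (x : Fin n → Bool) (i : Fin n) :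
    parity n (Function.update x i (!x i)) = !parity n x := by
  have key : ∀ x : Fin n → Bool, x i = false →
      parity n (Function.update x i true) = !parity n x := by
    intro x hx
    have : (Finset.univ.filter fun j => Function.update x i true j = true) =
        insert i (Finset.univ.filter fun j => x j = true) := by
      ext j
      by_cases hj : j = i <;> simp [hj]
    rw [parity, parity, this, Finset.card_insert_of_notMem (by simp [hx])]
    simp [Nat.odd_add_one, -Nat.not_odd_iff_even]
  cases hx : x i with
  | false => exact key x hx
  | true =>
    have := key (Function.update x i false) (by simp)
    rw [Function.update_idem, ← hx, Function.update_eq_self] at this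
    rw [this, Bool.not_not]
    simp

theorem flip_input (i : Fin n) (z : Bits (Qubit n p q)) :
    (fun j => flip (.input i) z (.input j)) =
      Function.update (fun j => z (.input j)) i (!z (.input i)) := by
  ext j
  by_cases hj : j = i
  · subst hj
    simp [flip]
  · simp [flip, hj]

theorem Qubit.card : Fintype.card (Qubit n p q) = n + 1 + p + q := by
  let e : Qubit n p q ≃ ((Fin n ⊕ Unit) ⊕ Fin p) ⊕ Fin q :=
    { toFun := fun
        | .input i => .inl (.inl (.inl i))
        | .output => .inl (.inl (.inr ()))
        | .initialized i => .inl (.inr i)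
        | .uninitialized i => .inr i
      invFun := fun
        | .inl (.inl (.inl i)) => .input i
        | .inl (.inl (.inr ())) => .output
        | .inl (.inr i) => .initialized i
        | .inr i => .uninitialized i
      left_inv := fun r => by cases r <;> rfl
      right_inv := fun r => by rcases r with ((r | r) | r) | r <;> rfl }
  simp [Fintype.card_congr e]

theorem card_filter_initialized :
    (Finset.univ.filter fun z : Bits (Qubit n p q) => ∀ i, z (.initialized i) = false).card *
      2 ^ p = 2 ^ Fintype.card (Qubit n p q) := by
  have hinj : Function.Injective (Qubit.initialized : Fin p → Qubit n p q) :=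
    fun i j h => by simpa using h
  have := card_filter_forall_eq_mul (Finset.univ.map ⟨_, hinj⟩) false
  simpa using this

/-- An operator whose output does not depend on the input bit `i` is far from every circuit that
computes parity. -/
theorem Circuit.Computes.le_norm_sub_sq {C : Circuit (Qubit n p q)} (hC : C.Computes (parity n))
    (U : Matrix (Bits (Qubit n p q)) (Bits (Qubit n p q)) ℂ) (i : Fin n)
    (hU : ∀ z, ‖outVec .output U (flip (.input i) z)‖ = ‖outVec .output U z‖) :
    (2 : ℝ) ^ Fintype.card (Qubit n p q) / 2 ^ p / 4 ≤ ‖C.matrix - U‖ ^ 2 := by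
  set G := Finset.univ.filter fun z : Bits (Qubit n p q) => ∀ i, z (.initialized i) = false
  have hcard : (G.card : ℝ) * 2 ^ p = 2 ^ Fintype.card (Qubit n p q) := by
    exact_mod_cast card_filter_initialized
  let e : Bits (Qubit n p q) → ℝ := fun z => ∑ z', ‖(C.matrix - U) z' z‖ ^ 2
  have hG : ∀ z ∈ G, flip (.input i) z ∈ G := by
    intro z hz
    simp only [G, Finset.mem_filter, Finset.mem_univ, true_and] at hz ⊢
    intro j
    simpa [flip] using hz j
  have hpair : ∀ z ∈ G, 1 / 2 ≤ e z + e (flip (.input i) z) := by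
    intro z hz
    have h₁ := sq_norm_outVec_sub_le Qubit.output C.matrix U z
    have h₂ := sq_norm_outVec_sub_le Qubit.output C.matrix U (flip (.input i) z)
    have hfz := hG z hz
    simp only [G, Finset.mem_filter, Finset.mem_univ, true_and] at hz hfz
    rw [hC.norm_outVec z hz] at h₁
    rw [hU, hC.norm_outVec _ hfz, flip_input, parity_update] at h₂
    have ho : flip (.input i) z .output = z .output := by simp [flip]
    rw [ho, Bool.xor_not] at h₂
    refine le_trans ?_ (add_le_add h₁ h₂)
    generalize ‖outVec .output U z‖ = r
    cases xor (z .output) (parity n fun i => z (.input i))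
    · simp only [Bool.false_eq_true, if_false, Bool.not_false, if_true]
      nlinarith [sq_nonneg (2 * r - 1)]
    · simp only [if_true, Bool.not_true, Bool.false_eq_true, if_false]
      nlinarith [sq_nonneg (2 * r - 1)]
  have hflip : ∑ z ∈ G, e (flip (.input i) z) = ∑ z ∈ G, e z :=
    Finset.sum_nbij' (flip (.input i)) (flip (.input i)) hG hG
      (fun z _ => flip_involutive _ z) (fun z _ => flip_involutive _ z) (fun _ _ => rfl)
  have hsum : (G.card : ℝ) * (1 / 2) ≤ 2 * ∑ z ∈ G, e z := by
    calc (G.card : ℝ) * (1 / 2) = ∑ z ∈ G, (1 / 2 : ℝ) := by rw [Finset.sum_const, nsmul_eq_mul]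
      _ ≤ ∑ z ∈ G, (e z + e (flip (.input i) z)) := Finset.sum_le_sum hpair
      _ = 2 * ∑ z ∈ G, e z := by rw [Finset.sum_add_distrib, hflip, two_mul]
  have hall : ∑ z ∈ G, e z ≤ ‖C.matrix - U‖ ^ 2 := by
    rw [frobenius_norm_sq, Finset.sum_comm (s := Finset.univ)]
    exact Finset.sum_le_univ_sum_of_nonneg (f := e) fun z => by positivity
  have : (2 : ℝ) ^ Fintype.card (Qubit n p q) / 2 ^ p = G.card := by
    rw [← hcard]
    field_simp
  rw [this]
  linarith

/-- All gates but the Toffoli gates with at least `K` controls. -/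
def Gate.isSmall {Q : Type} (K : ℕ) : Gate Q → Bool
  | .toffoli S _ _ _ => decide (S.card < K)
  | _ => true

theorem Gate.card_support_le {Q : Type} [DecidableEq Q] {K w : ℕ} (g : Gate Q)
    (hg : g.isSmall K = true) (hw : g.FanoutAtMost w) : g.support.card ≤ 2 + w + K := by
  cases g with
  | hadamard a => simp [Gate.support]; omega
  | phase a c t ht => simp [Gate.support]; omega
  | cnot c t h => exact Finset.card_le_two.trans (by omega)
  | fanout c T hne h =>
    have : (insert c T).card ≤ w := hw
    simp only [Gate.support]
    omega
  | toffoli S t hne h =>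
    have : S.card < K := by simpa [Gate.isSmall] using hg
    have := Finset.card_insert_le t S
    simp only [Gate.support]
    omega

/-- If the light cone of the small gates does not contain all inputs, then a
circuit for parity needs exponentially many gates. -/
theorem Circuit.Computes.two_pow_le {C : Circuit (Qubit n p q)} (hC : C.Computes (parity n))
    {d w : ℕ} (hd : C.depth ≤ d) (hw : ∀ g ∈ C, g.FanoutAtMost w) (K : ℕ)
    (hn : (2 + w + K) ^ d < n) : 2 ^ K ≤ 8 * (d * (n + 1 + p + q)) ^ 2 * 2 ^ p := by
  obtain ⟨S, hS, hcone⟩ := Circuit.exists_lightCone hd (Gate.isSmall K) (W := 2 + w + K) (by omega)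
    (fun g hg hk => g.card_support_le hk (hw g hg)) .output (proj .output)
    (commutesOutside_proj _)
  obtain ⟨i, hi⟩ : ∃ i : Fin n, Qubit.input i ∉ S := by
    by_contra! hall
    have : (Finset.univ.map ⟨(Qubit.input : Fin n → Qubit n p q), fun i j h => by
        simpa using h⟩).card ≤ S.card :=
      Finset.card_le_card fun r hr => by
        obtain ⟨i, -, rfl⟩ := Finset.mem_map.1 hr
        exact hall i
    rw [Finset.card_map, Finset.card_univ, Fintype.card_fin] at this
    omega
  have hlow := hC.le_norm_sub_sq _ i fun z => norm_outVec_flip hcone hi z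
  set N := Fintype.card (Qubit n p q) with hN
  have hup := C.norm_matrix_sub_matrix_filter_le (Gate.isSmall K)
    (ε := Real.sqrt (2 * (2 ^ N / 2 ^ K))) (Real.sqrt_nonneg _) (by
      intro g _ hk
      cases g with
      | toffoli T t hne h =>
        have hKT : K ≤ T.card := by simpa [Gate.isSmall] using hk
        refine Real.le_sqrt_of_sq_le ((norm_toffoli_sub_one_sq_le T t hne h).trans ?_)
        gcongr
        norm_num
      | _ => simp [Gate.isSmall] at hk)
  have hlen : (C.length : ℝ) ≤ d * N := by exact_mod_cast Circuit.length_le hd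
  have hmul : (2 : ℝ) ^ N / 2 ^ p / 4 ≤ (d * N) ^ 2 * (2 * (2 ^ N / 2 ^ K)) := by
    calc _ ≤ _ := hlow
      _ ≤ (d * N * Real.sqrt (2 * (2 ^ N / 2 ^ K))) ^ 2 := by
          refine pow_le_pow_left₀ (norm_nonneg _) (hup.trans ?_) 2
          exact mul_le_mul_of_nonneg_right hlen (Real.sqrt_nonneg _)
      _ = _ := by rw [mul_pow, Real.sq_sqrt (by positivity)]
  have hfin : (2 : ℝ) ^ K ≤ 8 * (d * N) ^ 2 * 2 ^ p := by
    have h2N : (0 : ℝ) < 2 ^ N := by positivity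
    have h2p : (0 : ℝ) < 2 ^ p := by positivity
    have h2K : (0 : ℝ) < 2 ^ K := by positivity
    rw [div_div, div_le_iff₀ (by positivity)] at hmul
    have : (2 : ℝ) ^ N * 2 ^ K ≤ 2 ^ N * (8 * (d * N) ^ 2 * 2 ^ p) := by
      calc (2 : ℝ) ^ N * 2 ^ K
          ≤ (d * N) ^ 2 * (2 * (2 ^ N / 2 ^ K)) * (2 ^ p * 4) * 2 ^ K :=
            mul_le_mul_of_nonneg_right hmul h2K.le
        _ = _ := by field_simp; ring
    exact le_of_mul_le_mul_left this h2N
  rw [Qubit.card] at hN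
  rw [hN] at hfin
  exact_mod_cast hfin

end Parity

section Asymptotics

open Filter Asymptotics

theorem tendsto_log_natCast : Tendsto (fun n : ℕ => Real.log n) atTop atTop :=
  Real.tendsto_log_atTop.comp tendsto_natCast_atTop_atTop

theorem exists_pos_eventually_le {f g : ℕ → ℝ} (h : f =O[atTop] g) (hg : ∀ᶠ n in atTop, 0 ≤ g n) :
    ∃ A : ℝ, 0 < A ∧ ∀ᶠ n in atTop, f n ≤ A * g n := by
  obtain ⟨A, hA, hb⟩ := h.exists_pos
  refine ⟨A, hA, ?_⟩
  filter_upwards [hb.bound, hg] with n hn hgn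
  rw [Real.norm_of_nonneg hgn] at hn
  exact (le_abs_self _).trans hn

theorem eventually_rpow_mul_log_lt {δ : ℝ} (hδ1 : δ < 1) (a b : ℝ) :
    ∀ᶠ x : ℝ in atTop, x ^ δ * (a + b * Real.log x) < x := by
  have h : (fun x : ℝ => a + b * Real.log x) =o[atTop] fun x => x ^ (1 - δ) := by
    refine IsLittleO.add ?_ ((isLittleO_log_rpow_atTop (sub_pos.2 hδ1)).const_mul_left b)
    exact isLittleO_const_left.2 (Or.inr
      (tendsto_norm_atTop_atTop.comp (tendsto_rpow_atTop (sub_pos.2 hδ1))))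
  filter_upwards [h.bound (by norm_num : (0 : ℝ) < 1 / 2), eventually_gt_atTop 0] with x hx hx0
  have hpos : 0 < x ^ δ := Real.rpow_pos_of_pos hx0 δ
  rw [Real.norm_of_nonneg (Real.rpow_nonneg hx0.le _)] at hx
  calc x ^ δ * (a + b * Real.log x) ≤ x ^ δ * (1 / 2 * x ^ (1 - δ)) :=
        mul_le_mul_of_nonneg_left ((le_abs_self _).trans hx) hpos.le
    _ = 1 / 2 * x := by
        rw [mul_left_comm, ← Real.rpow_add hx0, add_sub_cancel, Real.rpow_one]
    _ < x := by linarith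

theorem eventually_pow_lt {δ : ℝ} (hδ1 : δ < 1) {d w : ℕ → ℕ} (c : ℝ) (hc : 0 ≤ c)
    (hd : (fun n => (d n : ℝ)) =O[atTop] fun n : ℕ => Real.log n ^ δ)
    (hw : ∃ k : ℕ, (fun n => (w n : ℝ)) =O[atTop] fun n : ℕ => Real.log n ^ k) :
    ∀ᶠ n : ℕ in atTop, (2 + w n + ⌈c * Real.log n⌉₊) ^ d n < n := by
  have hlog : ∀ᶠ n : ℕ in atTop, 1 ≤ Real.log n := tendsto_log_natCast.eventually_ge_atTop 1
  obtain ⟨A, hA, hd⟩ := exists_pos_eventually_le hd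
    (hlog.mono fun n hn => Real.rpow_nonneg (by linarith) _)
  obtain ⟨k, hw⟩ := hw
  obtain ⟨F, hF, hw⟩ := exists_pos_eventually_le hw (hlog.mono fun n hn => by positivity)
  filter_upwards [hlog, hd, hw, eventually_gt_atTop 0,
    tendsto_log_natCast.eventually
      (eventually_rpow_mul_log_lt hδ1 (A * Real.log (3 + F + c)) (A * (k + 1)))]
    with n hL hd hw hn hlt
  set x := Real.log n
  have hn' : (0 : ℝ) < n := by exact_mod_cast hn
  have hbase : ((2 + w n + ⌈c * x⌉₊ : ℕ) : ℝ) ≤ (3 + F + c) * x ^ (k + 1) := by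
    have h₁ : (⌈c * x⌉₊ : ℝ) < c * x + 1 := Nat.ceil_lt_add_one (by positivity)
    have h₂ : x ^ k ≤ x ^ (k + 1) := pow_le_pow_right₀ hL (by omega)
    have h₃ : x ≤ x ^ (k + 1) := le_self_pow₀ hL (by omega)
    have h₄ : 1 ≤ x ^ (k + 1) := one_le_pow₀ hL
    push_cast
    nlinarith [mul_le_mul_of_nonneg_left h₂ hF.le, mul_le_mul_of_nonneg_left h₃ hc]
  have hlogb : Real.log ((2 + w n + ⌈c * x⌉₊ : ℕ) : ℝ) ≤
      Real.log (3 + F + c) + (k + 1) * Real.log x := by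
    refine (Real.log_le_log (by positivity) hbase).trans (le_of_eq ?_)
    rw [Real.log_mul (by positivity) (by positivity), Real.log_pow]
    push_cast
    rfl
  have hlog0 : 0 ≤ Real.log ((2 + w n + ⌈c * x⌉₊ : ℕ) : ℝ) := Real.log_natCast_nonneg _
  have : (((2 + w n + ⌈c * x⌉₊) ^ d n : ℕ) : ℝ) < n := by
    rw [Nat.cast_pow, ← Real.log_lt_log_iff (by positivity) hn', Real.log_pow]
    calc (d n : ℝ) * Real.log ((2 + w n + ⌈c * x⌉₊ : ℕ) : ℝ)
        ≤ A * x ^ δ * (Real.log (3 + F + c) + (k + 1) * Real.log x) :=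
          mul_le_mul hd hlogb hlog0 (by positivity)
      _ = x ^ δ * (A * Real.log (3 + F + c) + A * (k + 1) * Real.log x) := by ring
      _ < x := hlt
  exact_mod_cast this

theorem exists_eventually_lt_two_pow {δ : ℝ} (hδ1 : δ < 1) {d p q : ℕ → ℕ}
    (hd : (fun n => (d n : ℝ)) =O[atTop] fun n : ℕ => Real.log n ^ δ)
    (hp : (fun n => (p n : ℝ)) =O[atTop] fun n : ℕ => Real.log n)
    (hq : ∃ k : ℕ, (fun n => (q n : ℝ)) =O[atTop] fun n : ℕ => (n : ℝ) ^ k) :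
    ∃ c : ℝ, 0 ≤ c ∧ ∀ᶠ n : ℕ in atTop,
      8 * (d n * (n + 1 + p n + q n)) ^ 2 * 2 ^ p n < 2 ^ ⌈c * Real.log n⌉₊ := by
  have hlog : ∀ᶠ n : ℕ in atTop, 1 ≤ Real.log n := tendsto_log_natCast.eventually_ge_atTop 1
  obtain ⟨A, hA, hd⟩ := exists_pos_eventually_le hd
    (hlog.mono fun n hn => Real.rpow_nonneg (by linarith) _)
  obtain ⟨B, hB, hp⟩ := exists_pos_eventually_le hp (hlog.mono fun n hn => by linarith)
  obtain ⟨k, hq⟩ := hq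
  obtain ⟨E, hE, hq⟩ := exists_pos_eventually_le hq (Eventually.of_forall fun n => by positivity)
  refine ⟨2 * (2 * k + 5 + B), by positivity, ?_⟩
  filter_upwards [hlog, hd, hp, hq, eventually_gt_atTop 0,
    tendsto_natCast_atTop_atTop.eventually_gt_atTop (8 * (A * (2 + B + E)) ^ 2)]
    with n hL hd hp hq hn hlt
  have hn' : (1 : ℝ) ≤ n := by exact_mod_cast hn
  set x := Real.log n with hx
  have hexp : Real.exp x = n := Real.exp_log (by linarith)
  have hxn : x ≤ n := Real.log_le_self (by linarith)
  have hdn : (d n : ℝ) ≤ A * n := by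
    refine hd.trans (mul_le_mul_of_nonneg_left ?_ hA.le)
    exact (Real.rpow_le_rpow_of_exponent_le hL hδ1.le).trans (by rwa [Real.rpow_one])
  have hN : (n + 1 + p n + q n : ℝ) ≤ (2 + B + E) * n ^ (k + 1) := by
    have h₁ : (n : ℝ) ≤ n ^ (k + 1) := le_self_pow₀ hn' (by omega)
    have h₂ : (n : ℝ) ^ k ≤ n ^ (k + 1) := pow_le_pow_right₀ hn' (by omega)
    nlinarith [mul_le_mul_of_nonneg_left h₂ hE.le,
      mul_le_mul_of_nonneg_left (hxn.trans h₁) hB.le]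
  have hprod : (d n * (n + 1 + p n + q n) : ℝ) ≤ A * (2 + B + E) * n ^ (k + 2) := by
    calc (d n * (n + 1 + p n + q n) : ℝ) ≤ A * n * ((2 + B + E) * n ^ (k + 1)) :=
          mul_le_mul hdn hN (by positivity) (by positivity)
      _ = _ := by ring
  have htwo : (2 : ℝ) ^ p n ≤ Real.exp (B * x) := by
    calc (2 : ℝ) ^ p n ≤ Real.exp 1 ^ p n :=
          pow_le_pow_left₀ (by norm_num) (by linarith [Real.add_one_le_exp 1]) _
      _ = Real.exp (p n) := by rw [← Real.exp_nat_mul, mul_one]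
      _ ≤ _ := Real.exp_le_exp.2 hp
  have hK : Real.exp ((2 * k + 5 + B) * x) ≤ 2 ^ ⌈2 * (2 * k + 5 + B) * x⌉₊ := by
    rw [← Real.exp_log (two_pos : (0 : ℝ) < 2), ← Real.exp_nat_mul, Real.exp_log two_pos]
    refine Real.exp_le_exp.2 ?_
    have h₁ := Nat.le_ceil (2 * (2 * k + 5 + B) * x)
    have h₂ : (1 / 2 : ℝ) ≤ Real.log 2 := by linarith [Real.log_two_gt_d9]
    calc (2 * k + 5 + B) * x = 2 * (2 * k + 5 + B) * x * (1 / 2) := by ring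
      _ ≤ _ := mul_le_mul h₁ h₂ (by norm_num) (by positivity)
  have hmain : (8 * (d n * (n + 1 + p n + q n)) ^ 2 * 2 ^ p n : ℝ) <
      2 ^ ⌈2 * (2 * k + 5 + B) * x⌉₊ := by
    calc (8 * (d n * (n + 1 + p n + q n)) ^ 2 * 2 ^ p n : ℝ)
        ≤ 8 * (A * (2 + B + E) * n ^ (k + 2)) ^ 2 * Real.exp (B * x) := by gcongr
      _ = 8 * (A * (2 + B + E)) ^ 2 * (n ^ (2 * k + 4) * Real.exp (B * x)) := by ring
      _ < n * (n ^ (2 * k + 4) * Real.exp (B * x)) := by gcongr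
      _ = Real.exp ((2 * k + 5 + B) * x) := by
          rw [← hexp, ← Real.exp_nat_mul, ← Real.exp_add, ← Real.exp_add]
          congr 1
          push_cast
          ring
      _ ≤ _ := hK
  exact_mod_cast hmain

end Asymptotics

end QCircuit

theorem theorem3 (δ : ℝ) (hδ0 : 0 ≤ δ) (hδ1 : δ < 1) (d p q w : ℕ → ℕ)
    (hd : (fun n => (d n : ℝ)) =O[Filter.atTop] fun n : ℕ => Real.log n ^ δ)
    (hp : (fun n => (p n : ℝ)) =O[Filter.atTop] fun n : ℕ => Real.log n)
    (hq : ∃ k : ℕ, (fun n => (q n : ℝ)) =O[Filter.atTop] fun n : ℕ => (n : ℝ) ^ k)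
    (hw : ∃ k : ℕ, (fun n => (w n : ℝ)) =O[Filter.atTop] fun n : ℕ => Real.log n ^ k) :
    ∀ᶠ n : ℕ in Filter.atTop,
      ∀ C : QCircuit.Circuit (QCircuit.Qubit n (p n) (q n)),
        C.depth ≤ d n → (∀ g ∈ C, g.FanoutAtMost (w n)) →
          ¬ C.Computes (QCircuit.parity n) := by
  obtain ⟨c, hc, hlt⟩ := QCircuit.exists_eventually_lt_two_pow hδ1 hd hp hq
  filter_upwards [hlt, QCircuit.eventually_pow_lt hδ1 c hc hd hw] with n hlt hn C hdepth hfan hC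
  exact absurd (hC.two_pow_le hdepth hfan _ hn) (not_le.2 hlt)
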